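/- **Setting.** A measure network $\mathcal N_X=(X,\mu_X,\omega_X)$ consists of a compact Polish space $X$, a finite Borel measure $\mu_X$ and a bounded measurable kernel $\omega_X:X\times X\to[0,\infty)$; it is a probability measure network if $\mu_X(X)=1$. Let $\Omega:[0,\infty)\to[0,1]$ satisfy $\Omega(0)=1$, $\Omega(z)<1$ for $z>0$, and $\Omega(z+w)\le\Omega(z)\Omega(w)$. For $\delta>0$, define on the cone $(\mathbb R\times[0,\infty))/(\mathbb R\times\{0\})$ the function $\mathsf d_\delta\ge 0$ by $$\mathsf d_\delta([u,r],[v,s])^2=4\delta^2\Big(r^2+s^2-2rs\,\Omega\big(\tfrac{|u-v|}{2\delta}\big)\Big).$$ A semi-coupling of $\mu_X,\mu_Y$ is a pair $(\gamma_0,\gamma_1)$ of Borel measures on $X\times Y$ such that the first marginal of $\gamma_0$ is $\mu_X$ and the second marginal of $\gamma_1$ is $\mu_Y$; $\Gamma(\mu_X,\mu_Y)$ is the set of these, and $\Pi(\mu_X,\mu_Y)$ is the set of couplings. Put $$\mathsf{CGW}_\delta(\mathcal N_X,\mathcal N_Y)=\inf_{(\gamma_0,\gamma_1)\in\Gamma(\mu_X,\mu_Y)}\mathbf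 H_\delta(\gamma_0,\gamma_1)^{1/2},$$ $$\mathbf H_\delta(\gamma_0,\gamma_1)=\int_{(X\times Y)^2}\mathsf d_\delta\Big(\big[\omega_X(x,x'),\sqrt{f_0(x,y)f_0(x',y')}\big],\big[\omega_Y(y,y'),\sqrt{f_1(x,y)f_1(x',y')}\big]\Big)^2\,d\gamma(x,y)\,d\gamma(x',y'),$$ where $\gamma$ is a finite measure with $\gamma_0,\gamma_1\ll\gamma$ (for example $\gamma=\gamma_0+\gamma_1$; the value does not depend on the choice) and $f_i=d\gamma_i/d\gamma$. For probability measure networks put $$\mathsf{GW}_2(\mathcal N_X,\mathcal N_Y)=\tfrac12\inf_{\pi\in\Pi(\mu_X,\mu_Y)}\Big(\int_{(X\times Y)^2}|\omega_X(x,x')-\omega_Y(y,y')|^2\,d\pi(x,y)\,d\pi(x',y')\Big)^{1/2}.$$ A semi-coupling (resp. coupling) is called optimal if it attains the infimum defining $\mathsf{CGW}_\delta$ (resp. $\mathsf{GW}_2$). **Statement.** Let $\mathcal N_X$, $\mathcal N_Y$ be probability measure networks, and let $M$ be such that $|\omega_X(x,x')-\omega_Y(y,y')|\le M$ for all $x,x'\in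 X$ and $y,y'\in Y$. Assume that there are constants $C,C'\ge0$ and $a_1>0$ with $$\Omega(z)\ge1-Cz^2\quad(z\ge0),\qquad \Omega(z)\le1-Cz^2+C'z^4\quad(0\le z\le M/a_1).$$ Then $$\lim_{\delta\to\infty}\mathsf{CGW}_\delta(\mathcal N_X,\mathcal N_Y)=2\sqrt{2C}\;\mathsf{GW}_2(\mathcal N_X,\mathcal N_Y),$$ that is, the limit is $\sqrt{2C}\,\inf_{\pi\in\Pi(\mu_X,\mu_Y)}\|\omega_X-\omega_Y\|_{L^2(\pi\otimes\pi)}$. Moreover, if $\delta_n>0$, $\delta_n\to\infty$ and $(\gamma_0^n,\gamma_1^n)$ is an optimal semi-coupling for $\mathsf{CGW}_{\delta_n}$ for every $n$, then there are a subsequence and an optimal coupling $\pi$ for $\mathsf{GW}_2$ such that both $\gamma_0^n$ and $\gamma_1^n$ converge weakly to $\pi$ along the subsequence. -/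

import Mathlib

open MeasureTheory Filter Topology
open scoped NNReal ENNReal

noncomputable section

namespace ConicGW

/-- The axioms on the function `Ω : [0, ∞) → [0, 1]` that defines a cone distance. Only the
values of `Ω` at nonnegative reals are constrained, and only those are ever used. -/
structure IsConeProfile (Ω : ℝ → ℝ) : Prop where
  nonneg : ∀ z, 0 ≤ z → 0 ≤ Ω z
  le_one : ∀ z, 0 ≤ z → Ω z ≤ 1
  map_zero : Ω 0 = 1
  lt_one : ∀ z, 0 < z → Ω z < 1
  map_add_le : ∀ z w, 0 ≤ z → 0 ≤ w → Ω (z + w) ≤ Ω z * Ω w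

/-- The relation on `X × [0, ∞)` that collapses `X × {0}` to a point. -/
def coneSetoid (X : Type*) : Setoid (X × ℝ≥0) where
  r p q := p = q ∨ (p.2 = 0 ∧ q.2 = 0)
  iseqv :=
    { refl := fun _ => Or.inl rfl
      symm := by
        rintro p q (h | h)
        · exact Or.inl h.symm
        · exact Or.inr ⟨h.2, h.1⟩
      trans := by
        rintro p q r (rfl | h) (rfl | h')
        · exact Or.inl rfl
        · exact Or.inr h'
        · exact Or.inr h
        · exact Or.inr ⟨h.1, h'.2⟩ }

/-- The cone over `X`, as a set: `(X × [0, ∞)) / (X × {0})`. -/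
def Cone (X : Type*) : Type _ := Quotient (coneSetoid X)

/-- The point `[x, r]` of the cone. -/
def Cone.mk {X : Type*} (x : X) (r : ℝ≥0) : Cone X := Quotient.mk (coneSetoid X) (x, r)

/-- The cone distance with angle `δ` and profile `Ω`: its square at `[x, r]`, `[y, s]` is
`4 δ² (r² + s² - 2 r s Ω (d(x, y) / (2 δ)))`. -/
def coneDist {X : Type*} [MetricSpace X] (Ω : ℝ → ℝ) (δ : ℝ) : Cone X → Cone X → ℝ :=
  Quotient.lift₂
    (fun p q : X × ℝ≥0 => Real.sqrt (4 * δ ^ 2 *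
      ((p.2 : ℝ) ^ 2 + (q.2 : ℝ) ^ 2
        - 2 * (p.2 : ℝ) * (q.2 : ℝ) * Ω (dist p.1 q.1 / (2 * δ)))))
    (by
      rintro p q p' q' (rfl | ⟨h1, h2⟩) (rfl | ⟨h3, h4⟩)
      · rfl
      · simp [h3, h4]
      · simp [h1, h2]
      · simp [h1, h2, h3, h4])

theorem coneDist_mk {X : Type*} [MetricSpace X] (Ω : ℝ → ℝ) (δ : ℝ) (x y : X) (r s : ℝ≥0) :
    coneDist Ω δ (Cone.mk x r) (Cone.mk y s) =
      Real.sqrt (4 * δ ^ 2 * ((r : ℝ) ^ 2 + (s : ℝ) ^ 2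
        - 2 * (r : ℝ) * (s : ℝ) * Ω (dist x y / (2 * δ)))) := rfl

/-- A measure network: a finite Borel measure on a compact Polish space `X` with a bounded,
measurable, nonnegative kernel on `X × X`. -/
structure MeasureNetwork (X : Type*) [TopologicalSpace X] [CompactSpace X] [PolishSpace X]
    [MeasurableSpace X] [BorelSpace X] where
  μ : Measure X
  finite_μ : IsFiniteMeasure μ
  ω : X → X → ℝ
  nonneg_ω : ∀ x x', 0 ≤ ω x x'
  measurable_ω : Measurable (fun p : X × X => ω p.1 p.2)
  bounded_ω : ∃ B : ℝ, ∀ x x', ω x x' ≤ B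

section Networks

variable {X Y : Type*}
  [TopologicalSpace X] [CompactSpace X] [PolishSpace X] [MeasurableSpace X] [BorelSpace X]
  [TopologicalSpace Y] [CompactSpace Y] [PolishSpace Y] [MeasurableSpace Y] [BorelSpace Y]

/-- A probability measure network has total mass one. -/
def MeasureNetwork.IsProbability (N : MeasureNetwork X) : Prop := N.μ Set.univ = 1

/-- Semi-couplings of the measures of two networks: pairs `(γ₀, γ₁)` of finite Borel measures on
`X × Y` such that the first marginal of `γ₀` and the second marginal of `γ₁` are prescribed. (The
prescribed marginals are finite, so finiteness of `γ₀` and `γ₁` is no restriction.) -/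
def semiCouplings (N : MeasureNetwork X) (P : MeasureNetwork Y) :
    Set (FiniteMeasure (X × Y) × FiniteMeasure (X × Y)) :=
  {g | (g.1 : Measure (X × Y)).map Prod.fst = N.μ ∧ (g.2 : Measure (X × Y)).map Prod.snd = P.μ}

/-- Couplings: both marginals of a single measure are prescribed. -/
def couplings (N : MeasureNetwork X) (P : MeasureNetwork Y) : Set (FiniteMeasure (X × Y)) :=
  {π | (π : Measure (X × Y)).map Prod.fst = N.μ ∧ (π : Measure (X × Y)).map Prod.snd = P.μ}

/-- The Radon-Nikodym density `dα / dγ`, with values in `[0, ∞)`. -/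
def density (α γ : Measure (X × Y)) (z : X × Y) : ℝ≥0 := (α.rnDeriv γ z).toNNReal

/-- The conic Gromov-Wasserstein loss, computed with the reference measure `γ`. -/
def cgwLossRef (Ω : ℝ → ℝ) (δ : ℝ) (N : MeasureNetwork X) (P : MeasureNetwork Y)
    (γ γ₀ γ₁ : Measure (X × Y)) : ℝ :=
  ∫ q : (X × Y) × (X × Y),
    (coneDist Ω δ
      (Cone.mk (N.ω q.1.1 q.2.1) (NNReal.sqrt (density γ₀ γ q.1 * density γ₀ γ q.2)))
      (Cone.mk (P.ω q.1.2 q.2.2) (NNReal.sqrt (density γ₁ γ q.1 * density γ₁ γ q.2)))) ^ 2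
    ∂(γ.prod γ)

/-- The conic Gromov-Wasserstein loss `H_δ(γ₀, γ₁)`. Its value is the same for every reference
measure that dominates `γ₀` and `γ₁`; the reference measure chosen here is `γ₀ + γ₁`. -/
def cgwLoss (Ω : ℝ → ℝ) (δ : ℝ) (N : MeasureNetwork X) (P : MeasureNetwork Y)
    (g : FiniteMeasure (X × Y) × FiniteMeasure (X × Y)) : ℝ :=
  cgwLossRef Ω δ N P ((g.1 : Measure (X × Y)) + (g.2 : Measure (X × Y))) g.1 g.2

/-- The conic Gromov-Wasserstein distance. -/
def CGW (Ω : ℝ → ℝ) (δ : ℝ) (N : MeasureNetwork X) (P : MeasureNetwork Y) : ℝ :=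
  ⨅ g : semiCouplings N P, Real.sqrt (cgwLoss Ω δ N P g.1)

/-- A semi-coupling that attains the infimum defining `CGW`. -/
def IsOptimalSemiCoupling (Ω : ℝ → ℝ) (δ : ℝ) (N : MeasureNetwork X) (P : MeasureNetwork Y)
    (g : FiniteMeasure (X × Y) × FiniteMeasure (X × Y)) : Prop :=
  g ∈ semiCouplings N P ∧ Real.sqrt (cgwLoss Ω δ N P g) = CGW Ω δ N P

/-- The `L²(π ⊗ π)` norm of `ω_X - ω_Y`. -/
def distortion (N : MeasureNetwork X) (P : MeasureNetwork Y) (π : FiniteMeasure (X × Y)) : ℝ :=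
  Real.sqrt (∫ q : (X × Y) × (X × Y), |N.ω q.1.1 q.2.1 - P.ω q.1.2 q.2.2| ^ 2
    ∂((π : Measure (X × Y)).prod (π : Measure (X × Y))))

/-- The Gromov-Wasserstein distance of order two, with the normalizing factor `1 / 2`. -/
def GW₂ (N : MeasureNetwork X) (P : MeasureNetwork Y) : ℝ :=
  (1 / 2 : ℝ) * ⨅ π : couplings N P, distortion N P π.1

/-- A coupling that attains the infimum defining `GW₂`. -/
def IsOptimalCoupling (N : MeasureNetwork X) (P : MeasureNetwork Y)
    (π : FiniteMeasure (X × Y)) : Prop :=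
  π ∈ couplings N P ∧ (1 / 2 : ℝ) * distortion N P π = GW₂ N P

end Networks

end ConicGW

end

namespace ConicGW

/-! Write `r`, `s` for the products of densities and `Δ = ω_X - ω_Y`. The integrand of the loss
splits as `4δ²(√r - √s)² + 8δ²√r√s(1 - Ω(|Δ|/(2δ)))`. The first term penalizes the difference
between the two measures, ever more as `δ → ∞`. By the expansion of `Ω` at zero, the second tends to
`2C√r√s|Δ|²`, the integrand of the squared distortion.

Upper bound: for a coupling `π` the pair `(π, π)` is a semi-coupling. Its first term vanishes, and
the lower bound on `Ω` makes the loss at most `2C` times the squared distortion, for every `δ > 0`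
(`CGW_le`).

Lower bound: let the loss stay bounded along `δₙ → ∞`. The measure `m` whose density is the minimum
of the two densities is a common part of `γ₀` and `γ₁`. The first term forces the remainders to have
mass `O(1/δ)`, and the second bounds `2C∫|Δ|² d(m ⊗ m)` by the loss up to `O(1/δ²)`
(`exists_common_part`). By compactness `γ₀` subconverges weakly, and `m` and `γ₁` then have the same
limit `π`, which is therefore a coupling. The kernels are only measurable, so weak convergence does
not apply to them directly. They are approximated in `L²` by continuous functions, uniformly along
the sequence because the marginals of `m` are dominated by the given measures
(`eLpNorm_sub_le_of_tendsto`). Thus `√(2C)` times the distortion of `π` is at most the bound on the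
square root of the loss (`exists_subseq_tendsto_coupling`), which yields both the limit and the
optimality of `π`. -/

open scoped BoundedContinuousFunction

/-! ### Weak convergence and `L²` norms -/

/-- Products of finite measures depend continuously on the factor, at nonzero measures. -/
theorem tendsto_finiteMeasure_prod_self {Z ι : Type*} [TopologicalSpace Z]
    [SecondCountableTopology Z] [TopologicalSpace.PseudoMetrizableSpace Z] [MeasurableSpace Z]
    [BorelSpace Z] {l : Filter ι} {m : ι → FiniteMeasure Z} {π : FiniteMeasure Z} (hπ : π ≠ 0)
    (h : Tendsto m l (𝓝 π)) : Tendsto (fun i => (m i).prod (m i)) l (𝓝 (π.prod π)) := by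
  have hZ : Nonempty Z := by
    by_contra hne
    rw [not_nonempty_iff] at hne
    apply hπ
    rw [← FiniteMeasure.mass_zero_iff]
    have : (Set.univ : Set Z) = ∅ := Set.univ_eq_empty_iff.2 hne
    simp [FiniteMeasure.mass, this]
  -- Splitting off the mass reduces the claim to continuity of products of probability measures;
  -- normalization is continuous only away from zero.
  have key : ∀ ρ : FiniteMeasure Z, ρ.prod ρ =
      (ρ.mass * ρ.mass) • (ρ.normalize.prod ρ.normalize).toFiniteMeasure := by
    intro ρ
    apply Subtype.ext
    have h1 : (ρ : Measure Z) = ρ.mass • (ρ.normalize : Measure Z) := by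
      conv_lhs => rw [ρ.self_eq_mass_smul_normalize]
      rfl
    change (ρ : Measure Z).prod (ρ : Measure Z) = (ρ.mass * ρ.mass) •
      ((ρ.normalize : Measure Z).prod (ρ.normalize : Measure Z))
    have hs : ∀ (c : ℝ≥0) (η : Measure Z) [IsFiniteMeasure η],
        (c • η).prod (c • η) = (c * c) • η.prod η := fun c η _ => by
      rw [Measure.prod_smul_left, Measure.prod_smul_right, smul_smul]
    rw [h1, hs]
  rw [key π]
  simp_rw [key]
  have hn := FiniteMeasure.tendsto_normalize_of_tendsto h hπ
  have hp : Tendsto (fun i => ((m i).normalize.prod (m i).normalize).toFiniteMeasure) l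
      (𝓝 (π.normalize.prod π.normalize).toFiniteMeasure) := by
    refine (ProbabilityMeasure.tendsto_nhds_iff_toFiniteMeasure_tendsto_nhds _).1 ?_
    exact (ProbabilityMeasure.continuous_prod.tendsto (π.normalize, π.normalize)).comp
      (hn.prodMk_nhds hn)
  exact (h.mass.mul h.mass).smul hp

/-- The `L²` norm of a bounded continuous function is continuous for weak convergence. -/
theorem tendsto_eLpNorm_two {W ι : Type*} [TopologicalSpace W] [MeasurableSpace W]
    [OpensMeasurableSpace W] {l : Filter ι} {m : ι → FiniteMeasure W} {π : FiniteMeasure W}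
    (h : Tendsto m l (𝓝 π)) (f : W →ᵇ ℝ) :
    Tendsto (fun i => eLpNorm f 2 (m i : Measure W)) l (𝓝 (eLpNorm f 2 (π : Measure W))) := by
  have e : ∀ ρ : Measure W, eLpNorm f 2 ρ =
      (∫⁻ x, ((f.nnnorm * f.nnnorm : W →ᵇ ℝ≥0) x : ℝ≥0∞) ∂ρ) ^ (1 / (2 : ℝ)) := by
    intro ρ
    rw [eLpNorm_eq_lintegral_rpow_enorm_toReal (by norm_num) (by norm_num)]
    simp only [ENNReal.toReal_ofNat]
    congr 1
    refine lintegral_congr fun x => ?_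
    simp [enorm_eq_nnnorm, sq]
  simp_rw [e]
  exact (ENNReal.continuous_rpow_const.tendsto _).comp
    (FiniteMeasure.tendsto_iff_forall_lintegral_tendsto.1 h _)

/-- If the first marginal of `m` is at most `μ`, then so is the first marginal of `m ⊗ m`
at most `μ ⊗ μ`, in the form of an inequality between `L^p` norms. -/
theorem eLpNorm_comp_prodMap_le {Z X : Type*} [MeasurableSpace Z] [MeasurableSpace X]
    {m : Measure Z} [IsFiniteMeasure m] {μ : Measure X} [IsFiniteMeasure μ] {q : Z → X}
    (hq : Measurable q) (hm : m.map q ≤ μ) {F : X × X → ℝ} (hF : AEStronglyMeasurable F (μ.prod μ))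
    (p : ℝ≥0∞) :
    eLpNorm (F ∘ Prod.map q q) p (m.prod m) ≤ eLpNorm F p (μ.prod μ) := by
  have h : (m.prod m).map (Prod.map q q) ≤ μ.prod μ := by
    rw [← Measure.map_prod_map _ _ hq hq]
    exact Measure.prod_mono hm hm
  rw [← eLpNorm_map_measure (hF.mono_measure h) (hq.prodMap hq).aemeasurable]
  exact eLpNorm_mono_measure _ h

/-- Lower semicontinuity of the `L²` norm of a function of the form `F (x, x') - G (y, y')` with
merely measurable `F` and `G`, along weakly convergent measures with controlled marginals. -/
theorem eLpNorm_sub_le_of_tendsto {X Y ι : Type*}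
    [TopologicalSpace X] [PolishSpace X] [MeasurableSpace X] [BorelSpace X]
    [TopologicalSpace Y] [PolishSpace Y] [MeasurableSpace Y] [BorelSpace Y]
    {μ : Measure X} [IsFiniteMeasure μ] {ν : Measure Y} [IsFiniteMeasure ν]
    {F : X × X → ℝ} {G : Y × Y → ℝ} (hF : MemLp F 2 (μ.prod μ)) (hG : MemLp G 2 (ν.prod ν))
    {l : Filter ι} [l.NeBot] {m : ι → FiniteMeasure (X × Y)} {π : FiniteMeasure (X × Y)}
    (hπ0 : π ≠ 0) (h : Tendsto m l (𝓝 π))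
    (hm₁ : ∀ i, (m i : Measure (X × Y)).map Prod.fst ≤ μ)
    (hm₂ : ∀ i, (m i : Measure (X × Y)).map Prod.snd ≤ ν)
    (hπ₁ : (π : Measure (X × Y)).map Prod.fst ≤ μ) (hπ₂ : (π : Measure (X × Y)).map Prod.snd ≤ ν)
    {K : ι → ℝ≥0∞} {K₀ : ℝ≥0∞} (hK : Tendsto K l (𝓝 K₀))
    (hle : ∀ᶠ i in l, eLpNorm (F ∘ Prod.map Prod.fst Prod.fst - G ∘ Prod.map Prod.snd Prod.snd) 2
      ((m i : Measure (X × Y)).prod (m i : Measure (X × Y))) ≤ K i) :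
    eLpNorm (F ∘ Prod.map Prod.fst Prod.fst - G ∘ Prod.map Prod.snd Prod.snd) 2
      ((π : Measure (X × Y)).prod (π : Measure (X × Y))) ≤ K₀ := by
  refine ENNReal.le_of_forall_pos_le_add fun ε hε _ => ?_
  have hε4 : (ε : ℝ≥0∞) / 4 ≠ 0 := by
    simpa using hε.ne'
  obtain ⟨f, hf, -⟩ := hF.exists_boundedContinuous_eLpNorm_sub_le (by norm_num) hε4
  obtain ⟨g, hg, -⟩ := hG.exists_boundedContinuous_eLpNorm_sub_le (by norm_num) hε4
  let D : (X × Y) × (X × Y) → ℝ :=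
    F ∘ Prod.map Prod.fst Prod.fst - G ∘ Prod.map Prod.snd Prod.snd
  let d : (X × Y) × (X × Y) →ᵇ ℝ :=
    f.compContinuous ⟨Prod.map Prod.fst Prod.fst, by fun_prop⟩ -
      g.compContinuous ⟨Prod.map Prod.snd Prod.snd, by fun_prop⟩
  -- The error is uniform over all `ρ` with dominated marginals. It is used twice, along the
  -- sequence and at the limit, so the two kernels get `ε / 4` each.
  have hdist : ∀ ρ : FiniteMeasure (X × Y), (ρ : Measure (X × Y)).map Prod.fst ≤ μ →
      (ρ : Measure (X × Y)).map Prod.snd ≤ ν →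
      AEStronglyMeasurable D ((ρ : Measure (X × Y)).prod (ρ : Measure (X × Y))) ∧
      eLpNorm (D - ⇑d) 2 ((ρ : Measure (X × Y)).prod (ρ : Measure (X × Y))) ≤ ε / 2 := by
    intro ρ h₁ h₂
    have q₁ : (((ρ : Measure (X × Y)).prod (ρ : Measure (X × Y))).map
        (Prod.map Prod.fst Prod.fst)) ≤ μ.prod μ := by
      rw [← Measure.map_prod_map _ _ measurable_fst measurable_fst]
      exact Measure.prod_mono h₁ h₁
    have q₂ : (((ρ : Measure (X × Y)).prod (ρ : Measure (X × Y))).map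
        (Prod.map Prod.snd Prod.snd)) ≤ ν.prod ν := by
      rw [← Measure.map_prod_map _ _ measurable_snd measurable_snd]
      exact Measure.prod_mono h₂ h₂
    have mF := (hF.1.mono_measure q₁).comp_measurable
      (measurable_fst.prodMap (measurable_fst : Measurable (Prod.fst : X × Y → X)))
    have mG := (hG.1.mono_measure q₂).comp_measurable
      (measurable_snd.prodMap (measurable_snd : Measurable (Prod.snd : X × Y → Y)))
    refine ⟨mF.sub mG, ?_⟩
    have hFf : AEStronglyMeasurable (F - ⇑f) (μ.prod μ) :=
      hF.1.sub f.continuous.aestronglyMeasurable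
    have hGg : AEStronglyMeasurable (G - ⇑g) (ν.prod ν) :=
      hG.1.sub g.continuous.aestronglyMeasurable
    have e : D - ⇑d = (F - ⇑f) ∘ Prod.map Prod.fst Prod.fst -
        (G - ⇑g) ∘ Prod.map Prod.snd Prod.snd := by
      ext q
      simp [D, d]
      ring
    rw [e]
    refine (eLpNorm_sub_le ((hFf.mono_measure q₁).comp_measurable
      (measurable_fst.prodMap measurable_fst)) ((hGg.mono_measure q₂).comp_measurable
      (measurable_snd.prodMap measurable_snd)) (by norm_num)).trans ?_
    refine (add_le_add ((eLpNorm_comp_prodMap_le measurable_fst h₁ hFf 2).trans hf)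
      ((eLpNorm_comp_prodMap_le measurable_snd h₂ hGg 2).trans hg)).trans ?_
    rw [← ENNReal.add_div, ← two_mul]
    refine le_of_eq ?_
    rw [show (4 : ℝ≥0∞) = 2 * 2 by norm_num,
      ENNReal.mul_div_mul_left _ _ (by norm_num) (by norm_num)]
  have hdm : ∀ᶠ i in l, eLpNorm d 2 ((m i : Measure (X × Y)).prod (m i : Measure (X × Y))) ≤
      K i + ε / 2 := by
    filter_upwards [hle] with i hi
    obtain ⟨hD, hDd⟩ := hdist (m i) (hm₁ i) (hm₂ i)
    have hdD : AEStronglyMeasurable (D - ⇑d)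
        ((m i : Measure (X × Y)).prod (m i : Measure (X × Y))) :=
      hD.sub d.continuous.aestronglyMeasurable
    have e : (d : (X × Y) × (X × Y) → ℝ) = D - (D - ⇑d) := by simp
    rw [e]
    exact (eLpNorm_sub_le hD hdD (by norm_num)).trans (add_le_add hi hDd)
  have hlim : eLpNorm d 2 ((π : Measure (X × Y)).prod (π : Measure (X × Y))) ≤ K₀ + ε / 2 :=
    le_of_tendsto_of_tendsto
      (tendsto_eLpNorm_two (tendsto_finiteMeasure_prod_self hπ0 h) d)
      (hK.add tendsto_const_nhds) hdm
  obtain ⟨hD, hDd⟩ := hdist π hπ₁ hπ₂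
  have e : D = ⇑d + (D - ⇑d) := by simp
  change eLpNorm D 2 _ ≤ _
  rw [e]
  refine (eLpNorm_add_le d.continuous.aestronglyMeasurable
    (hD.sub d.continuous.aestronglyMeasurable) (by norm_num)).trans
    ((add_le_add hlim hDd).trans ?_)
  rw [add_assoc, ENNReal.add_halves]

/-- Weak limits are insensitive to perturbations by measures of vanishing mass. -/
theorem tendsto_of_tendsto_add {W ι : Type*} [TopologicalSpace W] [MeasurableSpace W]
    [OpensMeasurableSpace W] {l : Filter ι} {m r : ι → FiniteMeasure W} {π : FiniteMeasure W}
    (h : Tendsto (fun i => m i + r i) l (𝓝 π)) (hr : Tendsto (fun i => (r i).mass) l (𝓝 0)) :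
    Tendsto m l (𝓝 π) := by
  have hr0 := FiniteMeasure.tendsto_zero_of_tendsto_zero_mass hr
  rw [FiniteMeasure.tendsto_iff_forall_integral_tendsto] at h hr0 ⊢
  intro f
  have := (h f).sub (hr0 f)
  simp only [FiniteMeasure.toMeasure_zero, integral_zero_measure, sub_zero] at this
  refine this.congr fun i => ?_
  rw [FiniteMeasure.toMeasure_add, integral_add_measure (f.integrable _) (f.integrable _)]
  ring

/-! ### Pointwise bounds for the conic integrand -/

section Pointwise

variable {Ω : ℝ → ℝ}

theorem conic_form_nonneg {r s ω : ℝ} (hr : 0 ≤ r) (hs : 0 ≤ s) (hω : ω ≤ 1) :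
    0 ≤ r + s - 2 * √r * √s * ω := by
  have h1 : 0 ≤ √r * √s * (1 - ω) := mul_nonneg (by positivity) (by linarith)
  have h2 := sq_nonneg (√r - √s)
  have h3 := Real.sq_sqrt hr
  have h4 := Real.sq_sqrt hs
  nlinarith

theorem coneDist_sqrt_sq (hΩ : IsConeProfile Ω) {δ : ℝ} (hδ : 0 < δ) (u v : ℝ) (r s : ℝ≥0) :
    coneDist Ω δ (Cone.mk u (NNReal.sqrt r)) (Cone.mk v (NNReal.sqrt s)) ^ 2 =
      4 * δ ^ 2 * ((r : ℝ) + s - 2 * √r * √s * Ω (|u - v| / (2 * δ))) := by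
  have h := conic_form_nonneg r.2 s.2 (hΩ.le_one (|u - v| / (2 * δ)) (by positivity))
  have hr : (√(r : ℝ)) ^ 2 = r := Real.sq_sqrt r.2
  have hs : (√(s : ℝ)) ^ 2 = s := Real.sq_sqrt s.2
  have er : ((NNReal.sqrt r : ℝ≥0) : ℝ) = √r := by simp
  have es : ((NNReal.sqrt s : ℝ≥0) : ℝ) = √s := by simp
  rw [coneDist_mk, er, es, hr, hs, Real.dist_eq, Real.sq_sqrt]
  exact mul_nonneg (by positivity) h

/-- Submultiplicativity and `Ω ≤ 1` make `Ω` antitone on `[0, ∞)`, and monotone functions are Borel.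
-/
theorem IsConeProfile.measurable_comp_abs (hΩ : IsConeProfile Ω) :
    Measurable fun z : ℝ => Ω |z| := by
  have hanti : Antitone fun z : ℝ => Ω (max z 0) := by
    intro z w hzw
    have h1 : 0 ≤ max z 0 := le_max_right _ _
    have h2 : 0 ≤ max w 0 - max z 0 := sub_nonneg.2 (max_le_max_right 0 hzw)
    have h3 := hΩ.map_add_le _ _ h1 h2
    rw [add_sub_cancel] at h3
    exact h3.trans (mul_le_of_le_one_right (hΩ.nonneg _ h1) (hΩ.le_one _ h2))
  have := hanti.measurable.comp (measurable_norm (α := ℝ))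
  simpa [Function.comp_def] using this

variable {δ r s Δ : ℝ}

theorem conic_integrand_le (hΩ : IsConeProfile Ω) (hδ : 0 < δ) :
    4 * δ ^ 2 * (r + s - 2 * √r * √s * Ω (|Δ| / (2 * δ))) ≤ 4 * δ ^ 2 * (r + s) := by
  have h0 := hΩ.nonneg (|Δ| / (2 * δ)) (by positivity)
  have : 0 ≤ 2 * √r * √s * Ω (|Δ| / (2 * δ)) := by positivity
  gcongr
  linarith

theorem conic_integrand_self_le {C : ℝ} (hlower : ∀ z : ℝ, 0 ≤ z → 1 - C * z ^ 2 ≤ Ω z)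
    (hδ : 0 < δ) (hr : 0 ≤ r) :
    4 * δ ^ 2 * (r + r - 2 * √r * √r * Ω (|Δ| / (2 * δ))) ≤ 2 * C * (r * |Δ| ^ 2) := by
  have h0 := hlower (|Δ| / (2 * δ)) (by positivity)
  have e : 2 * C * (r * |Δ| ^ 2) = 8 * δ ^ 2 * r * (C * (|Δ| / (2 * δ)) ^ 2) := by
    field_simp
    ring
  rw [mul_assoc 2, Real.mul_self_sqrt hr, e]
  have : 0 ≤ 8 * δ ^ 2 * r := by positivity
  nlinarith

/-- With `a = √r` and `b = √s`, the integrand is at least `4δ²(a - b)²`. By AM-GM this is at least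
`4δ|a - b|(a + b) - (a + b)²`, where `|a - b|(a + b) = r + s - 2 min r s` and `(a + b)² ≤ 2(r + s)`.
-/
theorem le_conic_integrand_of_min (hΩ : IsConeProfile Ω) (hδ : 0 < δ) (hr : 0 ≤ r) (hs : 0 ≤ s) :
    4 * δ * (r + s - 2 * min r s) - 2 * (r + s) ≤
      4 * δ ^ 2 * (r + s - 2 * √r * √s * Ω (|Δ| / (2 * δ))) := by
  have h1 := hΩ.le_one (|Δ| / (2 * δ)) (by positivity)
  obtain ⟨a, ha, rfl⟩ : ∃ a, 0 ≤ a ∧ r = a ^ 2 := ⟨√r, by positivity, (Real.sq_sqrt hr).symm⟩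
  obtain ⟨b, hb, rfl⟩ : ∃ b, 0 ≤ b ∧ s = b ^ 2 := ⟨√s, by positivity, (Real.sq_sqrt hs).symm⟩
  rw [Real.sqrt_sq ha, Real.sqrt_sq hb]
  have h2 : 4 * δ ^ 2 * (a - b) ^ 2 ≤
      4 * δ ^ 2 * (a ^ 2 + b ^ 2 - 2 * a * b * Ω (|Δ| / (2 * δ))) := by
    have : 0 ≤ a * b * (1 - Ω (|Δ| / (2 * δ))) := mul_nonneg (by positivity) (by linarith)
    gcongr
    nlinarith
  refine le_trans ?_ h2
  rcases le_total a b with hab | hab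
  · rw [min_eq_left (by gcongr)]
    nlinarith [sq_nonneg (2 * δ * (b - a) - (a + b)), sq_nonneg (a - b)]
  · rw [min_eq_right (by gcongr)]
    nlinarith [sq_nonneg (2 * δ * (a - b) - (a + b)), sq_nonneg (a - b)]

/-- The term `(√r - √s)²` is dropped and `√r√s ≥ p` is used. The condition `a₁ ≤ 2δ` places
`|Δ|/(2δ)` in the range of the upper expansion. -/
theorem le_conic_integrand {C C' a₁ M p : ℝ} (hΩ : IsConeProfile Ω) (hC' : 0 ≤ C') (ha₁ : 0 < a₁)
    (hupper : ∀ z ∈ Set.Icc (0 : ℝ) (M / a₁), Ω z ≤ 1 - C * z ^ 2 + C' * z ^ 4)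
    (hδ : 0 < δ) (hδa : a₁ ≤ 2 * δ) (hp : 0 ≤ p) (hpr : p ≤ r) (hps : p ≤ s) (hΔ : |Δ| ≤ M) :
    p * (2 * C * |Δ| ^ 2 - C' * M ^ 4 / (2 * δ ^ 2)) ≤
      4 * δ ^ 2 * (r + s - 2 * √r * √s * Ω (|Δ| / (2 * δ))) := by
  have hz : 0 ≤ |Δ| / (2 * δ) := by positivity
  have hM : 0 ≤ M := (abs_nonneg _).trans hΔ
  have h1 := hΩ.le_one _ hz
  have h2 := hupper (|Δ| / (2 * δ)) ⟨hz, by gcongr⟩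
  have e1 : 8 * δ ^ 2 * (C * (|Δ| / (2 * δ)) ^ 2) = 2 * C * |Δ| ^ 2 := by
    field_simp
    ring
  have e2 : 8 * δ ^ 2 * (C' * (|Δ| / (2 * δ)) ^ 4) = C' * |Δ| ^ 4 / (2 * δ ^ 2) := by
    field_simp
    ring
  have h3 : 2 * C * |Δ| ^ 2 - C' * M ^ 4 / (2 * δ ^ 2) ≤
      8 * δ ^ 2 * (1 - Ω (|Δ| / (2 * δ))) := by
    have : C' * |Δ| ^ 4 / (2 * δ ^ 2) ≤ C' * M ^ 4 / (2 * δ ^ 2) := by gcongr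
    have : 8 * δ ^ 2 * (C * (|Δ| / (2 * δ)) ^ 2 - C' * (|Δ| / (2 * δ)) ^ 4) ≤
        8 * δ ^ 2 * (1 - Ω (|Δ| / (2 * δ))) := by
      exact mul_le_mul_of_nonneg_left (by linarith) (by positivity)
    linarith
  have h4 : p ≤ √r * √s := by
    rw [← Real.mul_self_sqrt hp]
    gcongr
  have hr := Real.sq_sqrt (hp.trans hpr)
  have hs := Real.sq_sqrt (hp.trans hps)
  -- The bracket on the left may be negative, so it is replaced by the nonnegative `8δ²(1 - Ω)`
  -- before `p` is enlarged to `√r√s`.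
  calc p * (2 * C * |Δ| ^ 2 - C' * M ^ 4 / (2 * δ ^ 2))
      ≤ p * (8 * δ ^ 2 * (1 - Ω (|Δ| / (2 * δ)))) := by gcongr
    _ ≤ (√r * √s) * (8 * δ ^ 2 * (1 - Ω (|Δ| / (2 * δ)))) := by
        refine mul_le_mul_of_nonneg_right h4 (mul_nonneg (by positivity) (by linarith))
    _ ≤ 4 * δ ^ 2 * (√r - √s) ^ 2 + (√r * √s) * (8 * δ ^ 2 * (1 - Ω (|Δ| / (2 * δ)))) := by
        have : 0 ≤ 4 * δ ^ 2 * (√r - √s) ^ 2 := by positivity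
        linarith
    _ = 4 * δ ^ 2 * (√r ^ 2 + √s ^ 2 - 2 * √r * √s * Ω (|Δ| / (2 * δ))) := by ring
    _ = _ := by rw [hr, hs]

end Pointwise

/-! ### Integrals against densities -/

section Densities

variable {Z : Type*} [MeasurableSpace Z] {γ : Measure Z}

theorem integral_prod_withDensity_self [IsFiniteMeasure γ] {p : Z → ℝ≥0} (hp : Measurable p)
    (h : Z × Z → ℝ) :
    ∫ q, h q ∂((γ.withDensity fun z => (p z : ℝ≥0∞)).prod (γ.withDensity fun z => (p z : ℝ≥0∞))) =
      ∫ q, ((p q.1 : ℝ) * p q.2) * h q ∂(γ.prod γ) := by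
  have e : (γ.withDensity fun z => (p z : ℝ≥0∞)).prod (γ.withDensity fun z => (p z : ℝ≥0∞)) =
      (γ.prod γ).withDensity fun q => ((p q.1 * p q.2 : ℝ≥0) : ℝ≥0∞) := by
    rw [prod_withDensity hp.coe_nnreal_ennreal hp.coe_nnreal_ennreal]
    simp
  rw [e, integral_withDensity_eq_integral_smul (by fun_prop)]
  simp [NNReal.smul_def]

theorem measureReal_univ_withDensity {p : Z → ℝ≥0} (hp : Measurable p) :
    (γ.withDensity fun z => (p z : ℝ≥0∞)).real Set.univ = ∫ z, (p z : ℝ) ∂γ := by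
  have := integral_withDensity_eq_integral_smul (μ := γ) hp (fun _ => (1 : ℝ))
  simpa [NNReal.smul_def] using this

theorem integrable_coe_of_isFiniteMeasure_withDensity {p : Z → ℝ≥0} (hp : Measurable p)
    [IsFiniteMeasure (γ.withDensity fun z => (p z : ℝ≥0∞))] :
    Integrable (fun z => (p z : ℝ)) γ := by
  have h : Integrable (fun _ : Z => (1 : ℝ)) (γ.withDensity fun z => (p z : ℝ≥0∞)) :=
    integrable_const 1
  rw [integrable_withDensity_iff_integrable_smul hp] at h
  simpa [NNReal.smul_def] using h

theorem integral_add_sub_linear {a b c : Z → ℝ} (ha : Integrable a γ) (hb : Integrable b γ)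
    (hc : Integrable c γ) (k : ℝ) :
    Integrable (fun z => k * (a z + b z - 2 * c z) - 2 * (a z + b z)) γ ∧
    ∫ z, (k * (a z + b z - 2 * c z) - 2 * (a z + b z)) ∂γ =
      k * (∫ z, a z ∂γ + ∫ z, b z ∂γ - 2 * ∫ z, c z ∂γ)
        - 2 * (∫ z, a z ∂γ + ∫ z, b z ∂γ) := by
  have h1 : Integrable (fun z => a z + b z) γ := ha.add hb
  have h2 : Integrable (fun z => 2 * c z) γ := hc.const_mul 2
  have h3 : Integrable (fun z => a z + b z - 2 * c z) γ := h1.sub h2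
  refine ⟨(h3.const_mul k).sub (h1.const_mul 2), ?_⟩
  rw [integral_sub (h3.const_mul k) (h1.const_mul 2), integral_const_mul, integral_const_mul,
    integral_sub h1 h2, integral_const_mul, integral_add ha hb]

/-- For two densities of integral one, the integral over the product of the minimum of the tensor
squares is at most the integral of the minimum. -/
theorem integral_min_mul_le [IsFiniteMeasure γ] {f₀ f₁ : Z → ℝ≥0} (i₀ : Integrable (fun z => (f₀ z : ℝ)) γ)
    (i₁ : Integrable (fun z => (f₁ z : ℝ)) γ)
    (t₀ : ∫ z, (f₀ z : ℝ) ∂γ = 1) (t₁ : ∫ z, (f₁ z : ℝ) ∂γ = 1) :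
    Integrable (fun q : Z × Z => min ((f₀ q.1 : ℝ) * f₀ q.2) ((f₁ q.1 : ℝ) * f₁ q.2))
      (γ.prod γ) ∧
    ∫ q : Z × Z, min ((f₀ q.1 : ℝ) * f₀ q.2) ((f₁ q.1 : ℝ) * f₁ q.2) ∂(γ.prod γ) ≤
      ∫ z, min (f₀ z : ℝ) (f₁ z : ℝ) ∂γ := by
  have j : Integrable (fun q : Z × Z => min ((f₀ q.1 : ℝ) * f₀ q.2) ((f₁ q.1 : ℝ) * f₁ q.2))
      (γ.prod γ) := (i₀.mul_prod i₀).inf (i₁.mul_prod i₁)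
  refine ⟨j, ?_⟩
  rw [integral_prod _ j]
  refine integral_mono j.integral_prod_left (i₀.inf i₁) fun z => ?_
  have k : Integrable (fun w => min ((f₀ z : ℝ) * f₀ w) ((f₁ z : ℝ) * f₁ w)) γ :=
    (i₀.const_mul _).inf (i₁.const_mul _)
  -- Since both densities have integral one, the inner integral is at most `f₀ z` and at most `f₁
  -- z`.
  refine le_min ?_ ?_
  · refine (integral_mono k (i₀.const_mul _) fun w => min_le_left _ _).trans ?_
    rw [integral_const_mul, t₀, mul_one]
  · refine (integral_mono k (i₁.const_mul _) fun w => min_le_right _ _).trans ?_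
    rw [integral_const_mul, t₁, mul_one]

variable {X Y : Type*} [MeasurableSpace X] [MeasurableSpace Y]

theorem measurable_density (α γ : Measure (X × Y)) : Measurable (density α γ) :=
  (Measure.measurable_rnDeriv α γ).ennreal_toNNReal

theorem withDensity_density {α γ : Measure (X × Y)} [IsFiniteMeasure α] [IsFiniteMeasure γ]
    (h : α ≪ γ) : (γ.withDensity fun z => (density α γ z : ℝ≥0∞)) = α := by
  conv_rhs => rw [← Measure.withDensity_rnDeriv_eq α γ h]
  refine withDensity_congr_ae ?_
  filter_upwards [Measure.rnDeriv_lt_top α γ] with z hz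
  simp [density, ENNReal.coe_toNNReal hz.ne]

end Densities

/-! ### Estimates for the conic loss -/

section Loss

variable {X Y : Type*}
  [TopologicalSpace X] [CompactSpace X] [PolishSpace X] [MeasurableSpace X] [BorelSpace X]
  [TopologicalSpace Y] [CompactSpace Y] [PolishSpace Y] [MeasurableSpace Y] [BorelSpace Y]
  {N : MeasureNetwork X} {P : MeasureNetwork Y} {Ω : ℝ → ℝ} {δ : ℝ}

/-- The difference of the two kernels, as a function on `(X × Y)²`. -/
def kernelDiff (N : MeasureNetwork X) (P : MeasureNetwork Y) (q : (X × Y) × (X × Y)) : ℝ :=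
  N.ω q.1.1 q.2.1 - P.ω q.1.2 q.2.2

theorem measurable_kernelDiff : Measurable (kernelDiff N P) :=
  (N.measurable_ω.comp (by fun_prop : Measurable fun q : (X × Y) × (X × Y) => (q.1.1, q.2.1))).sub
    (P.measurable_ω.comp (by fun_prop : Measurable fun q : (X × Y) × (X × Y) => (q.1.2, q.2.2)))

theorem norm_kernelDiff_sq_le {M : ℝ} (hM : ∀ x x' y y', |N.ω x x' - P.ω y y'| ≤ M)
    (q : (X × Y) × (X × Y)) : ‖|kernelDiff N P q| ^ 2‖ ≤ M ^ 2 := by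
  have := hM q.1.1 q.2.1 q.1.2 q.2.2
  rw [Real.norm_of_nonneg (by positivity)]
  simp only [kernelDiff]
  gcongr

theorem integrable_kernelDiff_sq {M : ℝ} (hM : ∀ x x' y y', |N.ω x x' - P.ω y y'| ≤ M)
    (ρ : Measure ((X × Y) × (X × Y))) [IsFiniteMeasure ρ] :
    Integrable (fun q => |kernelDiff N P q| ^ 2) ρ := by
  refine Integrable.of_bound (C := M ^ 2)
    ((measurable_norm.comp measurable_kernelDiff).pow_const 2).aestronglyMeasurable
    (ae_of_all _ fun q => norm_kernelDiff_sq_le hM q)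

/-- The integrand of the conic loss. -/
noncomputable def conicIntegrand (Ω : ℝ → ℝ) (δ : ℝ) (N : MeasureNetwork X) (P : MeasureNetwork Y)
    (f₀ f₁ : X × Y → ℝ≥0) (q : (X × Y) × (X × Y)) : ℝ :=
  4 * δ ^ 2 * ((f₀ q.1 : ℝ) * f₀ q.2 + (f₁ q.1 : ℝ) * f₁ q.2
    - 2 * √((f₀ q.1 : ℝ) * f₀ q.2) * √((f₁ q.1 : ℝ) * f₁ q.2)
      * Ω (|kernelDiff N P q| / (2 * δ)))

theorem cgwLoss_eq (hΩ : IsConeProfile Ω) (hδ : 0 < δ)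
    (g : FiniteMeasure (X × Y) × FiniteMeasure (X × Y)) :
    cgwLoss Ω δ N P g = ∫ q, conicIntegrand Ω δ N P
      (density (g.1 : Measure (X × Y)) ((g.1 : Measure (X × Y)) + (g.2 : Measure (X × Y))))
      (density (g.2 : Measure (X × Y)) ((g.1 : Measure (X × Y)) + (g.2 : Measure (X × Y)))) q
      ∂(((g.1 : Measure (X × Y)) + (g.2 : Measure (X × Y))).prod
        ((g.1 : Measure (X × Y)) + (g.2 : Measure (X × Y)))) := by
  unfold cgwLoss cgwLossRef
  refine integral_congr_ae (ae_of_all _ fun q => ?_)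
  simp only [coneDist_sqrt_sq hΩ hδ, NNReal.coe_mul]
  rfl

theorem integrable_conicIntegrand (hΩ : IsConeProfile Ω) (hδ : 0 < δ) {γ : Measure (X × Y)}
    [IsFiniteMeasure γ] {f₀ f₁ : X × Y → ℝ≥0} (h₀ : Measurable f₀)
    (h₁ : Measurable f₁) (i₀ : Integrable (fun z => (f₀ z : ℝ)) γ)
    (i₁ : Integrable (fun z => (f₁ z : ℝ)) γ) :
    Integrable (conicIntegrand Ω δ N P f₀ f₁) (γ.prod γ) := by
  have hm : Measurable (fun q => Ω (|kernelDiff N P q| / (2 * δ))) := by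
    have := hΩ.measurable_comp_abs.comp
      ((measurable_kernelDiff (N := N) (P := P)).div_const (2 * δ))
    simpa only [Function.comp_def, abs_div, abs_of_pos (by positivity : 0 < 2 * δ)] using this
  refine (((i₀.mul_prod i₀).add (i₁.mul_prod i₁)).const_mul (4 * δ ^ 2)).mono' ?_
    (ae_of_all _ fun q => ?_)
  -- The factor involving `Ω` is made opaque, so that its measurability enters only through `hm`.
  · obtain ⟨w, hw⟩ : ∃ w : (X × Y) × (X × Y) → ℝ,
        w = fun q => Ω (|kernelDiff N P q| / (2 * δ)) := ⟨_, rfl⟩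
    have e : conicIntegrand Ω δ N P f₀ f₁ = fun q =>
        4 * δ ^ 2 * ((f₀ q.1 : ℝ) * f₀ q.2 + (f₁ q.1 : ℝ) * f₁ q.2
          - 2 * √((f₀ q.1 : ℝ) * f₀ q.2) * √((f₁ q.1 : ℝ) * f₁ q.2) * w q) := by
      subst hw
      rfl
    rw [e]
    rw [← hw] at hm
    have := h₀.coe_nnreal_real
    have := h₁.coe_nnreal_real
    exact Measurable.aestronglyMeasurable (by fun_prop)
  · have hnn : 0 ≤ conicIntegrand Ω δ N P f₀ f₁ q :=
      mul_nonneg (by positivity) (conic_form_nonneg (by positivity) (by positivity)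
        (hΩ.le_one _ (by positivity)))
    rw [Real.norm_of_nonneg hnn]
    exact conic_integrand_le hΩ hδ

theorem sqrt_cgwLoss_self_le (hΩ : IsConeProfile Ω) (hδ : 0 < δ) {C M : ℝ} (hC : 0 ≤ C)
    (hM : ∀ x x' y y', |N.ω x x' - P.ω y y'| ≤ M)
    (hlower : ∀ z : ℝ, 0 ≤ z → 1 - C * z ^ 2 ≤ Ω z) (π : FiniteMeasure (X × Y)) :
    √(cgwLoss Ω δ N P (π, π)) ≤ √(2 * C) * distortion N P π := by
  unfold distortion
  rw [← Real.sqrt_mul (by positivity)]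
  refine Real.sqrt_le_sqrt ?_
  rw [cgwLoss_eq hΩ hδ]
  simp only
  have hac : (π : Measure (X × Y)) ≪ (π : Measure (X × Y)) + (π : Measure (X × Y)) :=
    Measure.absolutelyContinuous_of_le (Measure.le_add_left le_rfl)
  have hw := withDensity_density hac
  have hf := measurable_density (π : Measure (X × Y))
    ((π : Measure (X × Y)) + (π : Measure (X × Y)))
  -- The value of the density is irrelevant: only its measurability and the identity `f γ = π` are
  -- used.
  generalize density (π : Measure (X × Y))
    ((π : Measure (X × Y)) + (π : Measure (X × Y))) = f at hw hf
  generalize hγ : (π : Measure (X × Y)) + (π : Measure (X × Y)) = γ at hw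
  have : IsFiniteMeasure γ := hγ ▸ inferInstance
  have hfin : IsFiniteMeasure (γ.withDensity fun z => (f z : ℝ≥0∞)) := by rw [hw]; infer_instance
  have i := integrable_coe_of_isFiniteMeasure_withDensity (γ := γ) hf
  have j := integrable_kernelDiff_sq hM ((π : Measure (X × Y)).prod (π : Measure (X × Y)))
  rw [show ∫ q, |N.ω q.1.1 q.2.1 - P.ω q.1.2 q.2.2| ^ 2
      ∂((π : Measure (X × Y)).prod (π : Measure (X × Y))) = ∫ q, |kernelDiff N P q| ^ 2
      ∂((π : Measure (X × Y)).prod (π : Measure (X × Y))) from rfl]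
  rw [← hw, integral_prod_withDensity_self hf, ← integral_const_mul]
  refine integral_mono (integrable_conicIntegrand hΩ hδ hf hf i i) ?_ fun q =>
    conic_integrand_self_le hlower hδ (by positivity)
  exact ((i.mul_prod i).mul_bdd (c := M ^ 2)
    ((measurable_norm.comp measurable_kernelDiff).pow_const 2).aestronglyMeasurable
    (ae_of_all _ fun q => norm_kernelDiff_sq_le hM q)).const_mul _

/-- The two members of a semi-coupling have a common part `m`, whose complement has mass
`O(1 / δ)` in terms of the conic loss, and whose distortion is controlled by the loss. -/
theorem exists_common_part (hΩ : IsConeProfile Ω) (hδ : 0 < δ) {C C' a₁ M : ℝ}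
    (hC' : 0 ≤ C') (ha₁ : 0 < a₁) (hM : ∀ x x' y y', |N.ω x x' - P.ω y y'| ≤ M)
    (hupper : ∀ z ∈ Set.Icc (0 : ℝ) (M / a₁), Ω z ≤ 1 - C * z ^ 2 + C' * z ^ 4)
    (g : FiniteMeasure (X × Y) × FiniteMeasure (X × Y))
    (h₀ : (g.1 : Measure (X × Y)) Set.univ = 1) (h₁ : (g.2 : Measure (X × Y)) Set.univ = 1) :
    ∃ m r₀ r₁ : FiniteMeasure (X × Y), g.1 = m + r₀ ∧ g.2 = m + r₁ ∧
      (r₀.mass : ℝ) ≤ (cgwLoss Ω δ N P g + 4) / (8 * δ) ∧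
      (r₁.mass : ℝ) ≤ (cgwLoss Ω δ N P g + 4) / (8 * δ) ∧
      (a₁ ≤ 2 * δ → 2 * C * ∫ q, |kernelDiff N P q| ^ 2
          ∂((m : Measure (X × Y)).prod (m : Measure (X × Y))) ≤
        cgwLoss Ω δ N P g + C' * M ^ 4 / (2 * δ ^ 2)) := by
  rw [cgwLoss_eq hΩ hδ]
  have w₀ := withDensity_density (α := (g.1 : Measure (X × Y)))
    (γ := (g.1 : Measure (X × Y)) + (g.2 : Measure (X × Y)))
    (Measure.absolutelyContinuous_of_le (Measure.le_add_right le_rfl))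
  have w₁ := withDensity_density (α := (g.2 : Measure (X × Y)))
    (γ := (g.1 : Measure (X × Y)) + (g.2 : Measure (X × Y)))
    (Measure.absolutelyContinuous_of_le (Measure.le_add_left le_rfl))
  have m₀ := measurable_density (g.1 : Measure (X × Y))
    ((g.1 : Measure (X × Y)) + (g.2 : Measure (X × Y)))
  have m₁ := measurable_density (g.2 : Measure (X × Y))
    ((g.1 : Measure (X × Y)) + (g.2 : Measure (X × Y)))
  generalize density (g.1 : Measure (X × Y))
    ((g.1 : Measure (X × Y)) + (g.2 : Measure (X × Y))) = f₀ at w₀ m₀ ⊢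
  generalize density (g.2 : Measure (X × Y))
    ((g.1 : Measure (X × Y)) + (g.2 : Measure (X × Y))) = f₁ at w₁ m₁ ⊢
  obtain ⟨γ, hγ⟩ : ∃ γ, (g.1 : Measure (X × Y)) + (g.2 : Measure (X × Y)) = γ := ⟨_, rfl⟩
  have : IsFiniteMeasure γ := hγ ▸ inferInstance
  rw [hγ] at w₀ w₁ ⊢
  have hfin₀ : IsFiniteMeasure (γ.withDensity fun z => (f₀ z : ℝ≥0∞)) := by
    rw [w₀]; infer_instance
  have hfin₁ : IsFiniteMeasure (γ.withDensity fun z => (f₁ z : ℝ≥0∞)) := by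
    rw [w₁]; infer_instance
  have i₀ := integrable_coe_of_isFiniteMeasure_withDensity (γ := γ) m₀
  have i₁ := integrable_coe_of_isFiniteMeasure_withDensity (γ := γ) m₁
  have t₀ : ∫ z, (f₀ z : ℝ) ∂γ = 1 := by
    rw [← measureReal_univ_withDensity m₀, w₀, Measure.real, h₀, ENNReal.toReal_one]
  have t₁ : ∫ z, (f₁ z : ℝ) ∂γ = 1 := by
    rw [← measureReal_univ_withDensity m₁, w₁, Measure.real, h₁, ENNReal.toReal_one]
  -- The common part is `p γ`, and the remainders have densities `f₀ - p` and `f₁ - p`.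
  let p : X × Y → ℝ≥0 := fun z => min (f₀ z) (f₁ z)
  have mp : Measurable p := m₀.min m₁
  have split : ∀ f : X × Y → ℝ≥0, Measurable f → (∀ z, p z ≤ f z) →
      (γ.withDensity fun z => (f z : ℝ≥0∞)) = (γ.withDensity fun z => (p z : ℝ≥0∞)) +
        γ.withDensity fun z => ((f z - p z : ℝ≥0) : ℝ≥0∞) := by
    intro f _ hpf
    rw [← withDensity_add_left mp.coe_nnreal_ennreal]
    congr 1
    ext z
    rw [Pi.add_apply, ← ENNReal.coe_add, add_tsub_cancel_of_le (hpf z)]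
  have s₀ := split f₀ m₀ fun z => min_le_left _ _
  have s₁ := split f₁ m₁ fun z => min_le_right _ _
  rw [w₀] at s₀
  rw [w₁] at s₁
  have le₀ := Measure.le_add_right (ν' := γ.withDensity fun z => ((f₀ z - p z : ℝ≥0) : ℝ≥0∞))
    (le_refl (γ.withDensity fun z => (p z : ℝ≥0∞)))
  have le₀' := Measure.le_add_left (ν' := γ.withDensity fun z => (p z : ℝ≥0∞))
    (le_refl (γ.withDensity fun z => ((f₀ z - p z : ℝ≥0) : ℝ≥0∞)))
  have le₁' := Measure.le_add_left (ν' := γ.withDensity fun z => (p z : ℝ≥0∞))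
    (le_refl (γ.withDensity fun z => ((f₁ z - p z : ℝ≥0) : ℝ≥0∞)))
  rw [← s₀] at le₀ le₀'
  rw [← s₁] at le₁'
  have fin_m : IsFiniteMeasure (γ.withDensity fun z => (p z : ℝ≥0∞)) :=
    isFiniteMeasure_of_le _ le₀
  have fin_r₀ : IsFiniteMeasure (γ.withDensity fun z => ((f₀ z - p z : ℝ≥0) : ℝ≥0∞)) :=
    isFiniteMeasure_of_le _ le₀'
  have fin_r₁ : IsFiniteMeasure (γ.withDensity fun z => ((f₁ z - p z : ℝ≥0) : ℝ≥0∞)) :=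
    isFiniteMeasure_of_le _ le₁'
  have ip := integrable_coe_of_isFiniteMeasure_withDensity (γ := γ) mp
  have iI := integrable_conicIntegrand (N := N) (P := P) hΩ hδ m₀ m₁ i₀ i₁
  obtain ⟨imin, hmin⟩ := integral_min_mul_le i₀ i₁ t₀ t₁
  have hp_le : ∫ z, (p z : ℝ) ∂γ ≤ 1 := by
    rw [← t₀]
    exact integral_mono ip i₀ fun z => by simp [p]
  -- Integrating `le_conic_integrand_of_min` with both total masses equal to one gives `8δ(1 - ∫
  -- min) - 4` on the left, with the minimum of the tensor squares; `integral_min_mul_le` passes to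
  -- `∫ p`.
  have hmass : 8 * δ * (1 - ∫ z, (p z : ℝ) ∂γ) ≤
      (∫ q, conicIntegrand Ω δ N P f₀ f₁ q ∂(γ.prod γ)) + 4 := by
    have j₀ := i₀.mul_prod i₀
    have j₁ := i₁.mul_prod i₁
    have e₀ : ∫ q : (X × Y) × (X × Y), (f₀ q.1 : ℝ) * f₀ q.2 ∂(γ.prod γ) = 1 := by
      rw [integral_prod_mul (fun z => (f₀ z : ℝ)) (fun z => (f₀ z : ℝ)), t₀, one_mul]
    have e₁ : ∫ q : (X × Y) × (X × Y), (f₁ q.1 : ℝ) * f₁ q.2 ∂(γ.prod γ) = 1 := by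
      rw [integral_prod_mul (fun z => (f₁ z : ℝ)) (fun z => (f₁ z : ℝ)), t₁, one_mul]
    obtain ⟨jl, el⟩ := integral_add_sub_linear j₀ j₁ imin (4 * δ)
    have hle := integral_mono jl iI fun q =>
      le_conic_integrand_of_min (Δ := kernelDiff N P q) hΩ hδ
        (r := (f₀ q.1 : ℝ) * f₀ q.2) (s := (f₁ q.1 : ℝ) * f₁ q.2) (by positivity) (by positivity)
    rw [el, e₀, e₁] at hle
    have : ∫ z, (p z : ℝ) ∂γ = ∫ z, min (f₀ z : ℝ) (f₁ z : ℝ) ∂γ := by simp [p]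
    rw [this]
    nlinarith
  have hr : ∀ f : X × Y → ℝ≥0, Measurable f → Integrable (fun z => (f z : ℝ)) γ →
      (∀ z, p z ≤ f z) → ∫ z, (f z : ℝ) ∂γ = 1 →
      (γ.withDensity fun z => ((f z - p z : ℝ≥0) : ℝ≥0∞)).real Set.univ ≤
        ((∫ q, conicIntegrand Ω δ N P f₀ f₁ q ∂(γ.prod γ)) + 4) / (8 * δ) := by
    intro f mf jf hpf tf
    rw [measureReal_univ_withDensity (p := fun z => f z - p z) (mf.sub mp),
      le_div_iff₀ (by positivity)]
    have : ∫ z, ((f z - p z : ℝ≥0) : ℝ) ∂γ = 1 - ∫ z, (p z : ℝ) ∂γ := by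
      rw [← tf, ← integral_sub jf ip]
      exact integral_congr_ae (ae_of_all _ fun z => NNReal.coe_sub (hpf z))
    rw [this]
    linarith
  refine ⟨⟨_, fin_m⟩, ⟨_, fin_r₀⟩, ⟨_, fin_r₁⟩, Subtype.ext s₀, Subtype.ext s₁,
    hr f₀ m₀ i₀ (fun z => min_le_left _ _) t₀, hr f₁ m₁ i₁ (fun z => min_le_right _ _) t₁,
    fun hδa => ?_⟩
  simp only [FiniteMeasure.toMeasure_mk]
  set m := γ.withDensity fun z => (p z : ℝ≥0∞) with hm
  -- The quartic error, integrated against `m ⊗ m`, costs at most `κ` because `m` has mass at most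
  -- one.
  set κ := C' * M ^ 4 / (2 * δ ^ 2) with hκ
  have hκ0 : 0 ≤ κ := by positivity
  have isq := integrable_kernelDiff_sq hM (m.prod m)
  have e : ∫ q, ((p q.1 : ℝ) * p q.2) * (2 * C * |kernelDiff N P q| ^ 2 - κ) ∂(γ.prod γ) =
      2 * C * (∫ q, |kernelDiff N P q| ^ 2 ∂(m.prod m)) - κ * (m.prod m).real Set.univ := by
    rw [← integral_prod_withDensity_self mp, ← hm, integral_sub (isq.const_mul _)
      (integrable_const _), integral_const_mul, integral_const, smul_eq_mul, mul_comm κ]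
  have hm1 : m.real Set.univ ≤ 1 := by rw [hm, measureReal_univ_withDensity mp]; exact hp_le
  have hmm : (m.prod m).real Set.univ ≤ 1 := by
    rw [← Set.univ_prod_univ, measureReal_prod_prod]
    exact mul_le_one₀ hm1 measureReal_nonneg hm1
  have hle := integral_mono (μ := γ.prod γ)
    (f := fun q => ((p q.1 : ℝ) * p q.2) * (2 * C * |kernelDiff N P q| ^ 2 - κ)) ?_ iI fun q =>
      le_conic_integrand hΩ hC' ha₁ hupper hδ hδa (by positivity)
        (mul_le_mul (by simp [p]) (by simp [p]) (by positivity) (by positivity))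
        (mul_le_mul (by simp [p]) (by simp [p]) (by positivity) (by positivity))
        (hM q.1.1 q.2.1 q.1.2 q.2.2)
  · rw [e] at hle
    have := mul_le_of_le_one_right hκ0 hmm
    linarith
  · have mD := (measurable_norm.comp (measurable_kernelDiff (N := N) (P := P))).pow_const 2
    refine (ip.mul_prod ip).mul_bdd (c := |2 * C| * M ^ 2 + |κ|)
      ((mD.const_mul _).sub_const _).aestronglyMeasurable (ae_of_all _ fun q => ?_)
    refine (norm_sub_le _ _).trans (add_le_add ?_ le_rfl)
    rw [norm_mul]
    exact mul_le_mul_of_nonneg_left (norm_kernelDiff_sq_le hM q) (norm_nonneg _)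

end Loss

/-! ### Compactness and comparison of the two infima -/

variable {X Y : Type*}
  [TopologicalSpace X] [CompactSpace X] [PolishSpace X] [MeasurableSpace X] [BorelSpace X]
  [TopologicalSpace Y] [CompactSpace Y] [PolishSpace Y] [MeasurableSpace Y] [BorelSpace Y]
  {N : MeasureNetwork X} {P : MeasureNetwork Y}

theorem MeasureNetwork.memLp_ω (N : MeasureNetwork X) (ρ : Measure (X × X)) [IsFiniteMeasure ρ]
    (p : ℝ≥0∞) : MemLp (fun q : X × X => N.ω q.1 q.2) p ρ := by
  obtain ⟨B, hB⟩ := N.bounded_ω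
  refine MemLp.of_bound N.measurable_ω.aestronglyMeasurable B (ae_of_all _ fun q => ?_)
  rw [Real.norm_of_nonneg (N.nonneg_ω _ _)]
  exact hB _ _

theorem univ_eq_one_of_mem_semiCouplings (hN : N.IsProbability) (hP : P.IsProbability)
    {g : FiniteMeasure (X × Y) × FiniteMeasure (X × Y)} (hg : g ∈ semiCouplings N P) :
    (g.1 : Measure (X × Y)) Set.univ = 1 ∧ (g.2 : Measure (X × Y)) Set.univ = 1 := by
  constructor
  · rw [← hN, ← hg.1, Measure.map_apply measurable_fst MeasurableSet.univ, Set.preimage_univ]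
  · rw [← hP, ← hg.2, Measure.map_apply measurable_snd MeasurableSet.univ, Set.preimage_univ]

theorem eLpNorm_kernelDiff {M : ℝ} (hM : ∀ x x' y y', |N.ω x x' - P.ω y y'| ≤ M)
    (ρ : Measure ((X × Y) × (X × Y))) [IsFiniteMeasure ρ] :
    eLpNorm (kernelDiff N P) 2 ρ = ENNReal.ofReal √(∫ q, |kernelDiff N P q| ^ 2 ∂ρ) := by
  have h : MemLp (kernelDiff N P) 2 ρ := MemLp.of_bound measurable_kernelDiff.aestronglyMeasurable M
    (ae_of_all _ fun q => hM q.1.1 q.2.1 q.1.2 q.2.2)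
  rw [h.eLpNorm_eq_integral_rpow_norm (by norm_num) (by norm_num)]
  simp [Real.sqrt_eq_rpow]

/-- A weak limit of measures with a fixed image under a continuous map has that image. -/
theorem map_eq_of_tendsto {Z W ι : Type*} [TopologicalSpace Z] [MeasurableSpace Z]
    [BorelSpace Z] [TopologicalSpace W] [PolishSpace W] [MeasurableSpace W] [BorelSpace W]
    {l : Filter ι} [l.NeBot] {m : ι → FiniteMeasure Z} {π : FiniteMeasure Z}
    (h : Tendsto m l (𝓝 π)) {q : Z → W} (hq : Continuous q) {μ : Measure W}
    (hm : ∀ i, (m i : Measure Z).map q = μ) : (π : Measure Z).map q = μ := by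
  obtain ⟨i₀⟩ : Nonempty ι := l.nonempty_of_neBot
  have h1 := FiniteMeasure.tendsto_map_of_tendsto_of_continuous m π h hq
  have h2 : (fun i => (m i).map q) = fun _ => (m i₀).map q := by
    funext i
    apply Subtype.ext
    change (m i : Measure Z).map q = (m i₀ : Measure Z).map q
    rw [hm, hm]
  rw [h2] at h1
  have h3 : (m i₀).map q = π.map q := tendsto_nhds_unique tendsto_const_nhds h1
  have h4 := congrArg (fun ρ : FiniteMeasure W => (ρ : Measure W)) h3
  simp only [FiniteMeasure.toMeasure_map, hm] at h4
  exact h4.symm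

/-- Semi-couplings of bounded loss at scales tending to infinity subconverge to a coupling, whose
distortion is bounded accordingly. -/
theorem exists_subseq_tendsto_coupling (hN : N.IsProbability) (hP : P.IsProbability)
    {Ω : ℝ → ℝ} (hΩ : IsConeProfile Ω) {C C' a₁ M : ℝ} (hC : 0 < C) (hC' : 0 ≤ C')
    (ha₁ : 0 < a₁) (hM : ∀ x x' y y', |N.ω x x' - P.ω y y'| ≤ M)
    (hupper : ∀ z ∈ Set.Icc (0 : ℝ) (M / a₁), Ω z ≤ 1 - C * z ^ 2 + C' * z ^ 4)
    {δ : ℕ → ℝ} {g : ℕ → FiniteMeasure (X × Y) × FiniteMeasure (X × Y)}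
    (hδ : ∀ n, 0 < δ n) (hδ' : Tendsto δ atTop atTop) (hg : ∀ n, g n ∈ semiCouplings N P)
    {K : ℝ} (hK : ∀ n, √(cgwLoss Ω (δ n) N P (g n)) ≤ K) :
    ∃ (φ : ℕ → ℕ) (π : FiniteMeasure (X × Y)), StrictMono φ ∧ π ∈ couplings N P ∧
      Tendsto (fun n => g (φ n)) atTop (𝓝 (π, π)) ∧ √(2 * C) * distortion N P π ≤ K := by
  have := N.finite_μ
  have := P.finite_μ
  have hK0 : 0 ≤ K := (Real.sqrt_nonneg _).trans (hK 0)
  have hL : ∀ n, cgwLoss Ω (δ n) N P (g n) ≤ K ^ 2 := fun n => (Real.sqrt_le_iff.1 (hK n)).2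
  have hmass := fun n => univ_eq_one_of_mem_semiCouplings hN hP (hg n)
  choose m r₀ r₁ e₀ e₁ b₀ b₁ hdis using fun n =>
    exists_common_part hΩ (hδ n) hC' ha₁ hM hupper (g n) (hmass n).1 (hmass n).2
  -- Probability measures on the compact space `X × Y` form a compact space, which supplies the
  -- subsequence.
  let ρ : ℕ → ProbabilityMeasure (X × Y) := fun n => ⟨(g n).1, ⟨(hmass n).1⟩⟩
  obtain ⟨π₀, φ, hφ, hlim⟩ := CompactSpace.tendsto_subseq ρ
  let π : FiniteMeasure (X × Y) := π₀.toFiniteMeasure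
  have hδφ : Tendsto (fun n => δ (φ n)) atTop atTop := hδ'.comp hφ.tendsto_atTop
  have lim₀ : Tendsto (fun n => (g (φ n)).1) atTop (𝓝 π) :=
    (ProbabilityMeasure.tendsto_nhds_iff_toFiniteMeasure_tendsto_nhds _).1 hlim
  have hbound : Tendsto (fun n => (K ^ 2 + 4) / (8 * δ (φ n))) atTop (𝓝 0) :=
    tendsto_const_nhds.div_atTop (hδφ.const_mul_atTop (by norm_num))
  have hmass0 : ∀ r : ℕ → FiniteMeasure (X × Y),
      (∀ n, ((r n).mass : ℝ) ≤ (cgwLoss Ω (δ n) N P (g n) + 4) / (8 * δ n)) →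
      Tendsto (fun n => (r (φ n)).mass) atTop (𝓝 0) := by
    intro r hr
    rw [← NNReal.tendsto_coe]
    refine squeeze_zero (fun n => NNReal.coe_nonneg _) (fun n => (hr (φ n)).trans ?_) hbound
    have := hδ (φ n)
    have := hL (φ n)
    gcongr
  have limm : Tendsto (fun n => m (φ n)) atTop (𝓝 π) :=
    tendsto_of_tendsto_add (r := fun n => r₀ (φ n)) (lim₀.congr fun n => e₀ (φ n)) (hmass0 r₀ b₀)
  have lim₁ : Tendsto (fun n => (g (φ n)).2) atTop (𝓝 π) := by
    have := limm.add (FiniteMeasure.tendsto_zero_of_tendsto_zero_mass (hmass0 r₁ b₁))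
    rw [add_zero] at this
    exact this.congr fun n => (e₁ (φ n)).symm
  have hπ₁ : (π : Measure (X × Y)).map Prod.fst = N.μ :=
    map_eq_of_tendsto lim₀ continuous_fst fun n => (hg (φ n)).1
  have hπ₂ : (π : Measure (X × Y)).map Prod.snd = P.μ :=
    map_eq_of_tendsto lim₁ continuous_snd fun n => (hg (φ n)).2
  -- The common part is only a submeasure, so its marginals are dominated by the prescribed ones
  -- rather than equal to them.
  have hm₁ : ∀ n, (m (φ n) : Measure (X × Y)).map Prod.fst ≤ N.μ := by
    intro n
    rw [← (hg (φ n)).1, e₀ (φ n)]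
    exact Measure.map_mono (Measure.le_add_right le_rfl) measurable_fst
  have hm₂ : ∀ n, (m (φ n) : Measure (X × Y)).map Prod.snd ≤ P.μ := by
    intro n
    rw [← (hg (φ n)).2, e₁ (φ n)]
    exact Measure.map_mono (Measure.le_add_right le_rfl) measurable_snd
  have hπ0 : π ≠ 0 := ProbabilityMeasure.toFiniteMeasure_nonzero π₀
  refine ⟨φ, π, hφ, ⟨hπ₁, hπ₂⟩, lim₀.prodMk_nhds lim₁, ?_⟩
  -- The bound `hdis` on the distortion of the common part, divided by `2C`, with the loss replaced
  -- by `K²`.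
  let k : ℕ → ℝ := fun n => (K ^ 2 + C' * M ^ 4 / (2 * δ (φ n) ^ 2)) / (2 * C)
  have hk : Tendsto k atTop (𝓝 (K ^ 2 / (2 * C))) := by
    have h1 : Tendsto (fun n => C' * M ^ 4 / (2 * δ (φ n) ^ 2)) atTop (𝓝 0) :=
      tendsto_const_nhds.div_atTop
        (((tendsto_pow_atTop two_ne_zero).comp hδφ).const_mul_atTop (by norm_num))
    have := (h1.const_add (K ^ 2)).div_const (2 * C)
    rwa [add_zero] at this
  have hle : ∀ᶠ n in atTop, eLpNorm (kernelDiff N P) 2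
      ((m (φ n) : Measure (X × Y)).prod (m (φ n) : Measure (X × Y))) ≤
        ENNReal.ofReal √(k n) := by
    filter_upwards [hδφ.eventually_ge_atTop a₁] with n hn
    rw [eLpNorm_kernelDiff hM]
    refine ENNReal.ofReal_le_ofReal (Real.sqrt_le_sqrt ?_)
    rw [le_div_iff₀ (by positivity), mul_comm]
    exact (hdis (φ n) (by linarith)).trans (by linarith [hL (φ n)])
  have key := eLpNorm_sub_le_of_tendsto (N.memLp_ω (N.μ.prod N.μ) 2) (P.memLp_ω (P.μ.prod P.μ) 2)
    hπ0 limm hm₁ hm₂ hπ₁.le hπ₂.le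
    (ENNReal.tendsto_ofReal ((Real.continuous_sqrt.tendsto _).comp hk)) hle
  change eLpNorm (kernelDiff N P) 2 _ ≤ _ at key
  rw [eLpNorm_kernelDiff hM, ENNReal.ofReal_le_ofReal_iff (by positivity)] at key
  calc √(2 * C) * distortion N P π ≤ √(2 * C) * √(K ^ 2 / (2 * C)) := by
        gcongr
        exact key
    _ = K := by
        rw [← Real.sqrt_mul (by positivity), mul_div_cancel₀ _ (by positivity), Real.sqrt_sq hK0]

theorem couplings_nonempty (hN : N.IsProbability) (hP : P.IsProbability) :
    Nonempty (couplings N P) := by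
  have := N.finite_μ
  have := P.finite_μ
  have h1 : N.μ Set.univ = 1 := hN
  have h2 : P.μ Set.univ = 1 := hP
  refine ⟨⟨⟨N.μ.prod P.μ, inferInstance⟩, ?_, ?_⟩⟩
  · simp [h2]
  · simp [h1]

theorem bddBelow_range_distortion :
    BddBelow (Set.range fun π : couplings N P => distortion N P π.1) :=
  ⟨0, by rintro _ ⟨π, rfl⟩; exact Real.sqrt_nonneg _⟩

theorem CGW_le (hN : N.IsProbability) (hP : P.IsProbability)
    {Ω : ℝ → ℝ} (hΩ : IsConeProfile Ω) {C M : ℝ} (hC : 0 ≤ C)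
    (hM : ∀ x x' y y', |N.ω x x' - P.ω y y'| ≤ M)
    (hlower : ∀ z : ℝ, 0 ≤ z → 1 - C * z ^ 2 ≤ Ω z) {δ : ℝ} (hδ : 0 < δ) :
    CGW Ω δ N P ≤ √(2 * C) * ⨅ π : couplings N P, distortion N P π.1 := by
  have := couplings_nonempty hN hP
  rw [Real.mul_iInf_of_nonneg (Real.sqrt_nonneg _)]
  refine le_ciInf fun π => ?_
  refine (ciInf_le ⟨0, ?_⟩ (⟨(π.1, π.1), π.2⟩ : semiCouplings N P)).trans
    (sqrt_cgwLoss_self_le hΩ hδ hC hM hlower π.1)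
  rintro _ ⟨g, rfl⟩
  exact Real.sqrt_nonneg _

end ConicGW

/-! ### The limit and the convergence of optimal semi-couplings -/

theorem corollary4p9
    {X Y : Type*}
    [TopologicalSpace X] [CompactSpace X] [PolishSpace X] [MeasurableSpace X] [BorelSpace X]
    [TopologicalSpace Y] [CompactSpace Y] [PolishSpace Y] [MeasurableSpace Y] [BorelSpace Y]
    (N : ConicGW.MeasureNetwork X) (P : ConicGW.MeasureNetwork Y)
    (hN : N.IsProbability) (hP : P.IsProbability)
    (Ω : ℝ → ℝ) (hΩ : ConicGW.IsConeProfile Ω)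
    (C C' a₁ M : ℝ) (hC : 0 ≤ C) (hC' : 0 ≤ C') (ha₁ : 0 < a₁)
    (hM : ∀ x x' y y', |N.ω x x' - P.ω y y'| ≤ M)
    (hlower : ∀ z : ℝ, 0 ≤ z → 1 - C * z ^ 2 ≤ Ω z)
    (hupper : ∀ z ∈ Set.Icc (0 : ℝ) (M / a₁), Ω z ≤ 1 - C * z ^ 2 + C' * z ^ 4) :
    Tendsto (fun δ : ℝ => ConicGW.CGW Ω δ N P) atTop
        (𝓝 (2 * Real.sqrt (2 * C) * ConicGW.GW₂ N P)) ∧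
      ∀ (δ : ℕ → ℝ)
        (g : ℕ → FiniteMeasure (X × Y) × FiniteMeasure (X × Y)),
        (∀ n, 0 < δ n) → Tendsto δ atTop atTop →
        (∀ n, ConicGW.IsOptimalSemiCoupling Ω (δ n) N P (g n)) →
        ∃ (φ : ℕ → ℕ) (π : FiniteMeasure (X × Y)),
          StrictMono φ ∧ ConicGW.IsOptimalCoupling N P π ∧
            Tendsto (fun n => g (φ n)) atTop (𝓝 (π, π)) := by
  -- `C = 0` would give `Ω 1 ≥ 1`. Positivity is needed to divide by `√(2C)`.
  have hC0 : 0 < C := by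
    have h1 := hlower 1 zero_le_one
    have h2 := hΩ.lt_one 1 one_pos
    linarith
  have hsqrt : 0 < Real.sqrt (2 * C) := Real.sqrt_pos.2 (by positivity)
  have hcoup := ConicGW.couplings_nonempty hN hP
  have hinf : ∀ π ∈ ConicGW.couplings N P,
      ⨅ π : ConicGW.couplings N P, ConicGW.distortion N P π.1 ≤ ConicGW.distortion N P π :=
    fun π hπ => ciInf_le ConicGW.bddBelow_range_distortion
      (⟨π, hπ⟩ : ConicGW.couplings N P)
  have hle : ∀ δ : ℝ, 0 < δ → ConicGW.CGW Ω δ N P ≤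
      Real.sqrt (2 * C) * ⨅ π : ConicGW.couplings N P, ConicGW.distortion N P π.1 :=
    fun δ hδ => ConicGW.CGW_le hN hP hΩ hC hM hlower hδ
  have hGW : 2 * Real.sqrt (2 * C) * ConicGW.GW₂ N P =
      Real.sqrt (2 * C) * ⨅ π : ConicGW.couplings N P, ConicGW.distortion N P π.1 := by
    unfold ConicGW.GW₂
    ring
  rw [hGW]
  set I := ⨅ π : ConicGW.couplings N P, ConicGW.distortion N P π.1 with hI
  constructor
  · refine tendsto_order.2 ⟨fun a ha => ?_, fun b hb => ?_⟩
    -- If `CGW ≤ a` for arbitrarily large `δ`, near-minimizers with value below the midpoint of `a`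
    -- and `√(2C) I` subconverge to a coupling of distortion less than `I`. Existence of optimal
    -- semi-couplings is not needed.
    · by_contra hcon
      rw [not_eventually] at hcon
      obtain ⟨δ, hδ', hδ⟩ := exists_seq_forall_of_frequently
        (hcon.and_eventually (eventually_gt_atTop 0))
      have : Nonempty (ConicGW.semiCouplings N P) :=
        hcoup.map fun π => ⟨(π.1, π.1), π.2⟩
      have hex : ∀ n, ∃ g ∈ ConicGW.semiCouplings N P,
          Real.sqrt (ConicGW.cgwLoss Ω (δ n) N P g) ≤ (a + Real.sqrt (2 * C) * I) / 2 := by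
        intro n
        have hlt : ConicGW.CGW Ω (δ n) N P < (a + Real.sqrt (2 * C) * I) / 2 := by
          have := not_lt.1 (hδ n).1
          linarith
        obtain ⟨g, hg⟩ := exists_lt_of_ciInf_lt hlt
        exact ⟨g.1, g.2, hg.le⟩
      choose g hg hgK using hex
      obtain ⟨φ, π, -, hπ, -, hd⟩ := ConicGW.exists_subseq_tendsto_coupling hN hP hΩ hC0 hC' ha₁
        hM hupper (fun n => (hδ n).2) hδ' hg hgK
      have := mul_le_mul_of_nonneg_left (hinf π hπ) hsqrt.le
      linarith
    · filter_upwards [eventually_gt_atTop 0] with δ hδ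
      exact (hle δ hδ).trans_lt hb
  · intro δ g hδ hδ' hg
    -- Here the bound `K` is `√(2C) I` itself, so the limit coupling has distortion at most `I` and
    -- is optimal.
    obtain ⟨φ, π, hφ, hπ, hlim, hd⟩ := ConicGW.exists_subseq_tendsto_coupling hN hP hΩ hC0 hC' ha₁
      hM hupper hδ hδ' (fun n => (hg n).1) fun n => (hg n).2.le.trans (hle (δ n) (hδ n))
    refine ⟨φ, π, hφ, ⟨hπ, ?_⟩, hlim⟩
    rw [le_antisymm (le_of_mul_le_mul_left hd hsqrt) (hinf π hπ)]
    rfl
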